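/- Let $X$ be a (Hausdorff) real locally convex space with topological dual $X^*$, and let $\{f_t\}_{t\in T}$ be an arbitrary family of proper, lower semicontinuous, convex functions $f_t:X\to[-\infty,+\infty]$, with pointwise supremum $f:=\sup_{t\in T}f_t$. For $g:X\to[-\infty,+\infty]$, $\gamma\ge 0$ and $x\in X$ let $$\partial_\gamma g(x):=\{x^*\in X^*:\ \langle x^*,y-x\rangle\le g(y)-g(x)+\gamma\ \text{ for all } y\in X\}$$ if $g(x)$ is finite, and $\partial_\gamma g(x):=\emptyset$ otherwise; put $\partial g:=\partial_0 g$. Let $\operatorname{dom} g:=\{x\in X: g(x)<+\infty\}$. For $A\subseteq X$ let $\mathrm N_A(x):=\partial\delta_A(x)$, where $\delta_A$ is $0$ on $A$ and $+\infty$ elsewhere. Let $T_\gamma(x):=\{t\in T: f_t(x)\ge f(x)-\gamma\}$, and let $\mathcal F_x$ be the family of all finite-dimensional linear subspaces of $X$ containing $x$. Then, for every $x\in X$, $$\partial f(x)=\bigcap_{L\in\mathcal F_x,\ \gamma>0}\operatorname{cl}^{w^*}\Bigl\{\operatorname{co}\Bigl(\bigcup_{t\in T_\gamma(x)}\partial_\gamma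 f_t(x)\Bigr)+\mathrm N_{\operatorname{dom} f\cap L}(x)\Bigr\},$$ where $\operatorname{co}$ denotes the convex hull and $\operatorname{cl}^{w^*}$ the closure in the weak$^*$ topology $w(X^*,X)$. -/

import Mathlib

open scoped Pointwise

namespace SupSubdiff

noncomputable section

/-- The effective domain of an extended-real-valued function. -/
def effDom {X : Type*} (f : X → EReal) : Set X :=
  {x | f x < ⊤}

/-- The epigraph of an extended-real-valued function, a subset of `X × ℝ`. -/
def epi {X : Type*} (f : X → EReal) : Set (X × ℝ) :=
  {p | f p.1 ≤ (p.2 : EReal)}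

/-- The class of proper lower semicontinuous convex functions `X → [-∞, +∞]`;
convexity means convexity of the epigraph. -/
structure IsGammaZero {X : Type*} [AddCommGroup X] [Module ℝ X] [TopologicalSpace X]
    (f : X → EReal) : Prop where
  dom_nonempty : (effDom f).Nonempty
  ne_bot : ∀ x, f x ≠ ⊥
  lsc : LowerSemicontinuous f
  convex : Convex ℝ (epi f)

/-- The `ε`-subdifferential of `f` at `x`, a subset of the topological dual of `X` (which carries
the weak-* topology); it is empty where `f x` is not finite. -/
def epsSubdiff {X : Type*} [AddCommGroup X] [Module ℝ X] [TopologicalSpace X]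
    (ε : ℝ) (f : X → EReal) (x : X) : Set (WeakDual ℝ X) :=
  {φ | f x ≠ ⊤ ∧ f x ≠ ⊥ ∧ ∀ y, ((φ (y - x) : ℝ) : EReal) ≤ f y - f x + (ε : EReal)}

/-- The Moreau-Rockafellar subdifferential. -/
def subdiff {X : Type*} [AddCommGroup X] [Module ℝ X] [TopologicalSpace X]
    (f : X → EReal) (x : X) : Set (WeakDual ℝ X) :=
  epsSubdiff 0 f x

open Classical in
/-- The indicator function of convex analysis: `0` on `A` and `+∞` off `A`. -/
def indicatorFun {X : Type*} (A : Set X) (x : X) : EReal :=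
  if x ∈ A then 0 else ⊤

/-- The `ε`-normal set of `A` at `x`: the `ε`-subdifferential of the indicator of `A`. -/
def epsNormal {X : Type*} [AddCommGroup X] [Module ℝ X] [TopologicalSpace X]
    (ε : ℝ) (A : Set X) (x : X) : Set (WeakDual ℝ X) :=
  epsSubdiff ε (indicatorFun A) x

/-- The normal cone of `A` at `x` (empty if `x ∉ A`). -/
def normalCone {X : Type*} [AddCommGroup X] [Module ℝ X] [TopologicalSpace X]
    (A : Set X) (x : X) : Set (WeakDual ℝ X) :=
  epsNormal 0 A x

/-- The pointwise supremum of a family of functions. -/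
def supFun {X T : Type*} (f : T → X → EReal) (x : X) : EReal :=
  ⨆ t, f t x

/-- The set of `ε`-active indices at `x`. -/
def activeIdx {X T : Type*} (f : T → X → EReal) (ε : ℝ) (x : X) : Set T :=
  {t | supFun f x - (ε : EReal) ≤ f t x}

/-- The family of finite-dimensional linear subspaces of `X` containing `x`. -/
def finDimThrough {X : Type*} [AddCommGroup X] [Module ℝ X] (x : X) : Set (Submodule ℝ X) :=
  {L | FiniteDimensional ℝ L ∧ x ∈ L}

end

end SupSubdiff

/-!
Let `φ` be a subgradient of `f = sup f_t` at `x`. By Hahn-Banach in the weak-* topology, `φ` lies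
in the closure attached to `L` and `γ` as soon as `φ v ≤ σ v` for every `v` on which the normal
cone to `dom f ∩ L` is nonpositive, where `σ` is the support function of the union of the
`γ`-subdifferentials of the `γ`-active `f_t`. These `v` form the closure of the cone of feasible
directions of `dom f ∩ L` at `x`.

For a feasible direction `y - x` with `y ∈ dom f`, suppose that `σ (y - x) ≤ D`. Then the epigraph
of every `f_t` meets the segment from `(x, f x - γ)` to `(y, f x + D)`. If `f_t` is inactive, this
happens above `x`; if it is active, the epigraph and the segment could otherwise be strictly
separated, and the separating functional would be a `γ`-subgradient with value greater than `D` at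
`y - x`. Convexity then puts all `f_t` below the segment from `(x, f x)` to `(y, f x + D)` at a
common parameter `η > 0`, so the subgradient inequality there gives `φ (y - x) ≤ D`.

A limit `v` of feasible directions becomes feasible, because `L` is finite-dimensional, when a small
multiple of a relative interior direction `w` is added; as `σ w` is finite, the inequality survives
the passage to the limit. Conversely, an element of all the closures satisfies the subgradient
inequality at `y` up to `2 * γ`, by taking for `L` the span of `x` and `y`.
-/

namespace SupSubdiff

open Set AffineMap

section ConvexFunctions

variable {X T : Type*}

theorem exists_coe_ge_of_mem_effDom {g : X → EReal} {y : X} (hy : y ∈ effDom g) :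
    ∃ b : ℝ, g y ≤ b := by
  obtain ⟨b, hb, -⟩ := EReal.lt_iff_exists_real_btwn.1 (show g y < ⊤ from hy)
  exact ⟨b, hb.le⟩

theorem mem_effDom_of_le_coe {g : X → EReal} {y : X} {b : ℝ} (h : g y ≤ b) : y ∈ effDom g :=
  h.trans_lt (EReal.coe_lt_top b)

theorem supFun_le_iff {f : T → X → EReal} {x : X} {c : EReal} :
    supFun f x ≤ c ↔ ∀ t, f t x ≤ c :=
  iSup_le_iff

theorem isClosed_epi [TopologicalSpace X] {g : X → EReal} (hg : LowerSemicontinuous g) :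
    IsClosed (epi g) :=
  hg.isClosed_epigraph.preimage
    (continuous_fst.prodMk (continuous_coe_real_ereal.comp continuous_snd))

theorem epi_supFun (f : T → X → EReal) : epi (supFun f) = ⋂ t, epi (f t) := by
  ext p
  simp [epi, supFun_le_iff]

theorem effDom_eq_image_epi (g : X → EReal) : effDom g = Prod.fst '' epi g := by
  ext y
  constructor
  · intro hy
    obtain ⟨b, hb⟩ := exists_coe_ge_of_mem_effDom hy
    exact ⟨(y, b), hb, rfl⟩
  · rintro ⟨p, hp, rfl⟩
    exact mem_effDom_of_le_coe hp

variable [AddCommGroup X] [Module ℝ X] {g : X → EReal} {x y : X} {a b d γ θ η : ℝ}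

theorem convex_effDom (hg : Convex ℝ (epi g)) : Convex ℝ (effDom g) := by
  rw [effDom_eq_image_epi]
  exact hg.linear_image (LinearMap.fst ℝ X ℝ)

theorem apply_lineMap_le (hg : Convex ℝ (epi g)) (hx : g x ≤ a) (hy : g y ≤ b)
    (hθ : θ ∈ Icc (0 : ℝ) 1) : g (lineMap x y θ) ≤ (lineMap a b θ : ℝ) := by
  have h : lineMap (x, a) (y, b) θ ∈ epi g := hg.lineMap_mem hx hy hθ
  rwa [epi, mem_ofPred_eq, fst_lineMap, snd_lineMap] at h

/-- The parameter `η` depends on `g` only through bounds on `g x` and `g y`, so it can be chosen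
uniformly over a family of functions. -/
theorem apply_lineMap_le_of_apply_lineMap_sub_le (hg : Convex ℝ (epi g)) (hx : g x ≤ a)
    (hy : g y ≤ b) (hγ : 0 ≤ γ) (hθ : θ ∈ Icc (0 : ℝ) 1)
    (hmid : g (lineMap x y θ) ≤ (lineMap (a - γ) d θ : ℝ)) (hη0 : 0 < η) (hη1 : η ≤ 1)
    (hη : η * |b - d| ≤ (1 - η) * γ) : g (lineMap x y η) ≤ (lineMap a d η : ℝ) := by
  rcases le_or_gt η θ with hle | hlt
  · have hθ0 : 0 < θ := hη0.trans_le hle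
    obtain ⟨τ, hτη⟩ : ∃ τ, τ * θ = η := ⟨η / θ, div_mul_cancel₀ _ hθ0.ne'⟩
    have hτ : τ ∈ Icc (0 : ℝ) 1 := ⟨by nlinarith, by nlinarith⟩
    have h := apply_lineMap_le hg hx hmid hτ
    rw [lineMap_lineMap_right, hτη] at h
    refine h.trans (EReal.coe_le_coe_iff.2 ?_)
    have hητ : η ≤ τ := hτη ▸ mul_le_of_le_one_right hτ.1 hθ.2
    simp only [lineMap_apply_ring', ← hτη] at hητ ⊢
    linarith [mul_le_mul_of_nonneg_right hητ hγ]
  · have hθ1 : 0 < 1 - θ := by linarith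
    obtain ⟨τ, hτθ⟩ : ∃ τ, τ * (1 - θ) = η - θ := ⟨_, div_mul_cancel₀ _ hθ1.ne'⟩
    have hτ : τ ∈ Icc (0 : ℝ) 1 := ⟨by nlinarith, by nlinarith⟩
    have hτη : 1 - (1 - τ) * (1 - θ) = η := by linarith
    have h := apply_lineMap_le hg hmid hy hτ
    rw [lineMap_lineMap_left, hτη] at h
    refine h.trans (EReal.coe_le_coe_iff.2 ?_)
    have hle : τ ≤ η := by linarith [mul_le_of_le_one_left hθ.1 hτ.2]
    have hτb : τ * (b - d) ≤ (1 - η) * γ :=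
      calc τ * (b - d) ≤ τ * |b - d| := mul_le_mul_of_nonneg_left (le_abs_self _) hτ.1
        _ ≤ η * |b - d| := mul_le_mul_of_nonneg_right hle (abs_nonneg _)
        _ ≤ (1 - η) * γ := hη
    simp only [lineMap_apply_ring', ← hτη] at hτb ⊢
    linarith

end ConvexFunctions

section Cones

variable {X : Type*} [AddCommGroup X] [Module ℝ X]

/-- The cone of feasible directions of `C` at `x`, generated by the vectors `z` with
`x + z ∈ C`. -/
def feasibleCone (C : Set X) (x : X) : PointedCone ℝ X :=
  PointedCone.hull ℝ ((x + ·) ⁻¹' C)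

theorem exists_add_smul_mem_of_mem_feasibleCone {C : Set X} (hC : Convex ℝ C) {x z : X}
    (hx : x ∈ C) (hz : z ∈ feasibleCone C x) : ∃ r : ℝ, 0 < r ∧ x + r • z ∈ C := by
  set D : Set X := (x + ·) ⁻¹' C
  have h0 : (ConvexCone.hull ℝ D).Pointed := ConvexCone.subset_hull (by simpa [D] using hx)
  have hz' : z ∈ ConvexCone.hull ℝ D :=
    Submodule.span_le (p := (ConvexCone.hull ℝ D).toPointedCone h0).2 ConvexCone.subset_hull hz
  obtain ⟨r, hr, y, hy, rfl⟩ :=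
    (ConvexCone.mem_hull_of_convex (hC.translate_preimage_right x)).1 hz'
  exact ⟨r⁻¹, inv_pos.2 hr, by simpa [inv_smul_smul₀ hr.ne'] using hy⟩

theorem feasibleCone_subset_submodule {C : Set X} {x : X} {L : Submodule ℝ X} (hC : C ⊆ L)
    (hx : x ∈ L) : (feasibleCone C x : Set X) ⊆ L :=
  Submodule.span_le (p := PointedCone.ofSubmodule L).2 fun _ hz =>
    (L.add_mem_iff_right hx).1 (hC hz)

variable [TopologicalSpace X]

theorem add_mem_of_mem_closure_of_mem_interior [IsTopologicalAddGroup X] {K : PointedCone ℝ X}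
    {v w : X} (hv : v ∈ closure (K : Set X)) (hw : w ∈ interior (K : Set X)) : v + w ∈ K := by
  have h : v + w ∈ (K : Set X) + interior (K : Set X) :=
    isOpen_interior.closure_add (K : Set X) ▸ add_mem_add hv hw
  obtain ⟨y, hy, z, hz, hyz⟩ := h
  exact hyz ▸ K.add_mem hy (interior_subset hz)

theorem smul_mem_interior [ContinuousConstSMul ℝ X] {K : PointedCone ℝ X} {w : X} {ε : ℝ}
    (hε : 0 < ε) (hw : w ∈ interior (K : Set X)) : ε • w ∈ interior (K : Set X) := by
  have hsub : ε • interior (K : Set X) ⊆ K :=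
    smul_set_subset_iff.2 fun _ hy => K.smul_mem hε.le (interior_subset hy)
  exact interior_maximal hsub (isOpen_interior.smul₀ hε.ne') (smul_mem_smul_set hw)

variable [IsTopologicalAddGroup X] [ContinuousSMul ℝ X]

theorem interior_nonempty_of_span_eq_top [T2Space X] [FiniteDimensional ℝ X] {K : PointedCone ℝ X}
    (hK : Submodule.span ℝ (K : Set X) = ⊤) : (interior (K : Set X)).Nonempty := by
  let b : Module.Basis _ ℝ X := .ofSpan hK.ge
  have hbK : ∀ i, b i ∈ K := fun i => Module.Basis.ofSpan_subset hK.ge (mem_range_self i)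
  have : Fintype _ := FiniteDimensional.fintypeBasisIndex b
  refine ⟨∑ i, b i, mem_interior.2 ⟨{y | ∀ i, 0 < b.coord i y}, fun y hy => ?_, ?_, ?_⟩⟩
  · rw [SetLike.mem_coe, ← b.sum_repr y]
    exact sum_mem fun i _ => K.smul_mem (hy i).le (hbK i)
  · simp only [ofPred_forall]
    exact isOpen_iInter_of_finite fun i =>
      isOpen_lt continuous_const (b.coord i).continuous_of_finiteDimensional
  · simp

theorem exists_add_smul_mem_of_finiteDimensional [T2Space X] {K : PointedCone ℝ X}
    {L : Submodule ℝ X} [FiniteDimensional ℝ L] (hKL : (K : Set X) ⊆ L) :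
    ∃ w ∈ K, ∀ v ∈ closure (K : Set X), ∀ ε : ℝ, 0 < ε → v + ε • w ∈ K := by
  set S : Submodule ℝ X := Submodule.span ℝ (K : Set X)
  have : FiniteDimensional ℝ S := Submodule.finiteDimensional_of_le (Submodule.span_le.2 hKL)
  have hKS : (K : Set X) ⊆ S := Submodule.subset_span
  let K' : PointedCone ℝ S := K.comap S.subtype
  have himage : ((↑) : S → X) '' K' = K :=
    (Subtype.image_preimage_coe (S : Set X) K).trans (inter_eq_right.2 hKS)
  obtain ⟨w, hw⟩ : (interior (K' : Set S)).Nonempty :=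
    interior_nonempty_of_span_eq_top Submodule.span_span_coe_preimage
  refine ⟨w, (interior_subset hw : w ∈ (K' : Set S)), fun v hv ε hε => ?_⟩
  have hvS : v ∈ S := closure_minimal hKS S.closed_of_finiteDimensional hv
  have hv' : (⟨v, hvS⟩ : S) ∈ closure (K' : Set S) := closure_subtype.2 (himage.symm ▸ hv)
  have h : ⟨v, hvS⟩ + ε • w ∈ K' :=
    add_mem_of_mem_closure_of_mem_interior hv' (smul_mem_interior hε hw)
  exact h

theorem exists_inseparable_add_smul_of_finiteDimensional {K : PointedCone ℝ X}
    {L : Submodule ℝ X} [FiniteDimensional ℝ L] (hKL : (K : Set X) ⊆ L) :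
    ∃ w ∈ K, ∀ v ∈ closure (K : Set X), ∀ ε : ℝ, 0 < ε → ∃ z ∈ K, Inseparable z (v + ε • w) := by
  let π : X →L[ℝ] SeparationQuotient X := SeparationQuotient.mkCLM ℝ X
  have hπKL : (K.map (π : X →ₗ[ℝ] SeparationQuotient X) : Set (SeparationQuotient X)) ⊆
      L.map (π : X →ₗ[ℝ] SeparationQuotient X) := image_mono hKL
  obtain ⟨_, ⟨w, hw, rfl⟩, h⟩ := exists_add_smul_mem_of_finiteDimensional hπKL
  refine ⟨w, hw, fun v hv ε hε => ?_⟩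
  have hπv := image_closure_subset_closure_image π.continuous (mem_image_of_mem π hv)
  obtain ⟨z, hz, hzv⟩ := h _ hπv ε hε
  exact ⟨z, hz, SeparationQuotient.mk_eq_mk.1 hzv⟩

end Cones

section Subdifferentials

variable {X T : Type*} [AddCommGroup X] [Module ℝ X] [TopologicalSpace X] {g : X → EReal}
  {A : Set X} {x : X} {a γ ε : ℝ} {φ : WeakDual ℝ X}

theorem mem_epsSubdiff_iff (ha : g x = a) :
    φ ∈ epsSubdiff ε g x ↔ ∀ (y : X) (b : ℝ), g y ≤ b → φ (y - x) ≤ b - a + ε := by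
  simp only [epsSubdiff, mem_ofPred_eq, ha, ne_eq, EReal.coe_ne_top, not_false_eq_true,
    EReal.coe_ne_bot, true_and]
  constructor
  · intro h y b hb
    have hyb : ((φ (y - x) : ℝ) : EReal) ≤ (b : EReal) - a + ε :=
      (h y).trans (add_le_add_left (EReal.sub_le_sub hb le_rfl) _)
    exact_mod_cast hyb
  · intro h y
    induction hy : g y using EReal.rec with
    | bot => linarith [h y (φ (y - x) + a - ε - 1) (hy.trans_le bot_le)]
    | top => simp
    | coe b => exact_mod_cast h y b hy.le

theorem exists_eq_coe_of_mem_epsSubdiff (hφ : φ ∈ epsSubdiff ε g x) : ∃ a : ℝ, g x = a :=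
  ⟨_, (EReal.coe_toReal hφ.1 hφ.2.1).symm⟩

theorem mem_of_mem_normalCone (hφ : φ ∈ normalCone A x) : x ∈ A := by
  by_contra hx
  exact hφ.1 (if_neg hx)

theorem mem_normalCone_iff (hx : x ∈ A) : φ ∈ normalCone A x ↔ ∀ y ∈ A, φ (y - x) ≤ 0 := by
  have ha : indicatorFun A x = ((0 : ℝ) : EReal) := if_pos hx
  rw [normalCone, epsNormal, mem_epsSubdiff_iff ha]
  constructor
  · intro h y hy
    simpa using h y 0 (if_pos hy).le
  · intro h y b hb
    by_cases hy : y ∈ A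
    · have hb0 : (0 : ℝ) ≤ b := by simpa [indicatorFun, hy] using hb
      linarith [h y hy]
    · simp [indicatorFun, hy] at hb

/-- The normal cone at a point of `A`, bundled as a pointed cone of the dual space. -/
def normalPointedCone (hx : x ∈ A) : PointedCone ℝ (WeakDual ℝ X) where
  carrier := normalCone A x
  zero_mem' := (mem_normalCone_iff hx).2 fun _ _ => le_rfl
  add_mem' hφ hψ := (mem_normalCone_iff hx).2 fun y hy =>
    add_nonpos ((mem_normalCone_iff hx).1 hφ y hy) ((mem_normalCone_iff hx).1 hψ y hy)
  smul_mem' r _ hφ := (mem_normalCone_iff hx).2 fun y hy =>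
    mul_nonpos_of_nonneg_of_nonpos r.2 ((mem_normalCone_iff hx).1 hφ y hy)

/-- The union of the `γ`-subdifferentials at `x` of the `γ`-active members of a family. -/
def activeSubdiff (f : T → X → EReal) (γ : ℝ) (x : X) : Set (WeakDual ℝ X) :=
  ⋃ t ∈ activeIdx f γ x, epsSubdiff γ (f t) x

theorem activeSubdiff_subset_epsSubdiff_supFun {f : T → X → EReal} (ha : supFun f x = a) :
    activeSubdiff f γ x ⊆ epsSubdiff (2 * γ) (supFun f) x := by
  refine iUnion₂_subset fun t ht φ hφ => (mem_epsSubdiff_iff ha).2 fun y b hb => ?_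
  obtain ⟨c, hc⟩ := exists_eq_coe_of_mem_epsSubdiff hφ
  have hac : a - γ ≤ c := by
    have h : supFun f x - (γ : EReal) ≤ f t x := ht
    rw [ha, hc] at h
    exact_mod_cast h
  linarith [(mem_epsSubdiff_iff hc).1 hφ y b (supFun_le_iff.1 hb t)]

end Subdifferentials

section SupportFunctions

variable {X : Type*} [AddCommGroup X] [Module ℝ X] [TopologicalSpace X] {A : Set (WeakDual ℝ X)}
  {φ : WeakDual ℝ X} {v z : X} {c r u : ℝ}

/-- The support function on `X` of a set of continuous functionals. It is `⊥` when the set is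
empty. -/
noncomputable def supportFun (A : Set (WeakDual ℝ X)) (v : X) : EReal :=
  ⨆ ψ ∈ A, ((ψ v : ℝ) : EReal)

theorem supportFun_le_coe_iff : supportFun A v ≤ u ↔ ∀ ψ ∈ A, ψ v ≤ u := by
  simp [supportFun]

theorem coe_le_supportFun_iff :
    (c : EReal) ≤ supportFun A v ↔ ∀ u : ℝ, (∀ ψ ∈ A, ψ v ≤ u) → c ≤ u := by
  simp only [← supportFun_le_coe_iff]
  refine ⟨fun h u hu => EReal.coe_le_coe_iff.1 (h.trans hu), fun h => ?_⟩
  exact EReal.le_of_forall_lt_iff_le.1 fun u hu => EReal.coe_le_coe_iff.2 (h u hu.le)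

theorem nonempty_of_coe_le_supportFun (h : (c : EReal) ≤ supportFun A v) : A.Nonempty := by
  by_contra! hA
  linarith [coe_le_supportFun_iff.1 h (c - 1) (by simp [hA])]

theorem coe_apply_le_supportFun_of_smul (hr : 0 < r)
    (h : (φ (r • z) : EReal) ≤ supportFun A (r • z)) : (φ z : EReal) ≤ supportFun A z := by
  simp only [coe_le_supportFun_iff, map_smul, smul_eq_mul] at h ⊢
  exact fun u hu =>
    le_of_mul_le_mul_left (h (r * u) fun ψ hψ => mul_le_mul_of_nonneg_left (hu ψ hψ) hr.le) hr

theorem mem_effDom_supportFun_of_smul (hr : 0 < r) (h : r • z ∈ effDom (supportFun A)) :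
    z ∈ effDom (supportFun A) := by
  obtain ⟨b, hb⟩ := exists_coe_ge_of_mem_effDom h
  simp only [supportFun_le_coe_iff, map_smul, smul_eq_mul] at hb
  exact mem_effDom_of_le_coe (supportFun_le_coe_iff.2 fun ψ hψ => (le_div_iff₀' hr).2 (hb ψ hψ))

theorem mem_closure_of_forall_coe_le_supportFun (hA : Convex ℝ A)
    (h : ∀ v, (φ v : EReal) ≤ supportFun A v) : φ ∈ closure A := by
  by_contra hφ
  have : LocallyConvexSpace ℝ (WeakDual ℝ X) :=
    inferInstanceAs (LocallyConvexSpace ℝ (WeakBilin (topDualPairing ℝ X)))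
  obtain ⟨F, u, hF, hu⟩ := geometric_hahn_banach_closed_point hA.closure isClosed_closure hφ
  obtain ⟨v, hv⟩ := LinearMap.dualEmbedding_surjective (topDualPairing ℝ X) F
  have hFv : ∀ ψ : WeakDual ℝ X, F ψ = ψ v := fun ψ => by rw [← hv]; rfl
  simp only [hFv] at hF hu
  exact hu.not_ge (coe_le_supportFun_iff.1 (h v) u fun ψ hψ => (hF ψ (subset_closure hψ)).le)

theorem mem_closure_convexHull_add {N : PointedCone ℝ (WeakDual ℝ X)}
    (h : ∀ v, (∀ ν ∈ N, ν v ≤ 0) → (φ v : EReal) ≤ supportFun A v) :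
    φ ∈ closure (convexHull ℝ A + (N : Set (WeakDual ℝ X))) := by
  refine mem_closure_of_forall_coe_le_supportFun
    ((convex_convexHull ℝ A).add N.toConvexCone.convex) fun v => ?_
  refine coe_le_supportFun_iff.2 fun u hu => ?_
  have hsum : ∀ ψ ∈ A, ∀ ν ∈ N, ψ v + ν v ≤ u := fun ψ hψ ν hν =>
    hu (ψ + ν) (add_mem_add (subset_convexHull ℝ A hψ) hν)
  obtain ⟨ψ, hψ⟩ : A.Nonempty := nonempty_of_coe_le_supportFun (h 0 fun ν _ => (map_zero ν).le)
  have hN : ∀ ν ∈ N, ν v ≤ 0 := by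
    intro ν hν
    by_contra! hpos
    obtain ⟨n, hn⟩ := exists_nat_gt ((u - ψ v) / ν v)
    have hle : ψ v + n * ν v ≤ u := hsum ψ hψ ((n : ℝ) • ν) (N.smul_mem n.cast_nonneg hν)
    linarith [(div_lt_iff₀ hpos).1 hn]
  exact coe_le_supportFun_iff.1 (h v hN) u fun ψ hψ =>
    (add_zero (ψ v)).symm.trans_le (hsum ψ hψ 0 N.zero_mem)

variable [IsTopologicalAddGroup X] [ContinuousSMul ℝ X]

theorem mem_closure_feasibleCone [LocallyConvexSpace ℝ X] {C : Set X} {x : X} (hx : x ∈ C)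
    (hv : ∀ ν ∈ normalCone C x, ν v ≤ 0) : v ∈ closure (feasibleCone C x : Set X) := by
  by_contra hvK
  obtain ⟨F, hF, hFv⟩ := ProperCone.hyperplane_separation_point
    (⟨(feasibleCone C x).closure, isClosed_closure⟩ : ProperCone ℝ X) hvK
  have hmem : StrongDual.toWeakDual (-F) ∈ normalCone C x :=
    (mem_normalCone_iff hx).2 fun y hy => neg_nonpos.2 <| hF _ <| subset_closure <|
      Submodule.subset_span <| by simpa using hy
  exact hFv.not_ge (neg_nonpos.1 (hv _ hmem))

theorem coe_apply_le_supportFun_of_mem_closure {K : PointedCone ℝ X} {L : Submodule ℝ X}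
    [FiniteDimensional ℝ L] (hKL : (K : Set X) ⊆ L) (hdom : (K : Set X) ⊆ effDom (supportFun A))
    (hK : ∀ z ∈ K, (φ z : EReal) ≤ supportFun A z) (hv : v ∈ closure (K : Set X)) :
    (φ v : EReal) ≤ supportFun A v := by
  refine coe_le_supportFun_iff.2 fun u hu => le_of_forall_pos_le_add fun δ hδ => ?_
  obtain ⟨w, hw, hperturb⟩ := exists_inseparable_add_smul_of_finiteDimensional hKL
  obtain ⟨D, hD⟩ := exists_coe_ge_of_mem_effDom (hdom hw)
  rw [supportFun_le_coe_iff] at hD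
  obtain ⟨ε, hε, hεδ⟩ : ∃ ε : ℝ, 0 < ε ∧ ε * (|D - φ w| + 1) = δ :=
    ⟨δ / (|D - φ w| + 1), by positivity, div_mul_cancel₀ _ (by positivity)⟩
  obtain ⟨z, hz, hzv⟩ := hperturb v hv ε hε
  have happly : ∀ ψ : WeakDual ℝ X, ψ z = ψ v + ε * ψ w := fun ψ => by
    rw [(hzv.map (map_continuous ψ)).eq, map_add, map_smul, smul_eq_mul]
  have hle : φ v + ε * φ w ≤ u + ε * D := by
    rw [← happly]
    refine coe_le_supportFun_iff.1 (hK z hz) _ fun ψ hψ => ?_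
    rw [happly]
    exact add_le_add (hu ψ hψ) (mul_le_mul_of_nonneg_left (hD ψ hψ) hε.le)
  linarith [mul_le_mul_of_nonneg_left (le_abs_self (D - φ w)) hε.le]

end SupportFunctions

section Separation

variable {X T : Type*} [AddCommGroup X] [Module ℝ X] [TopologicalSpace X]
  [IsTopologicalAddGroup X] [ContinuousSMul ℝ X] [LocallyConvexSpace ℝ X] {x y : X}

theorem exists_mem_epsSubdiff_lt_apply_sub {g : X → EReal} {a d ε : ℝ}
    (hlsc : LowerSemicontinuous g) (hconv : Convex ℝ (epi g)) (ha : g x = a) (hε : 0 < ε)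
    (hdisj : Disjoint (epi g) (segment ℝ (x, a - ε) (y, d))) :
    ∃ φ ∈ epsSubdiff ε g x, d - a < φ (y - x) := by
  have hcomp : IsCompact (segment ℝ (x, a - ε) (y, d)) := by
    rw [segment_eq_image']
    exact isCompact_Icc.image (by fun_prop)
  obtain ⟨F, u, w, hFu, huw, hFw⟩ := geometric_hahn_banach_closed_compact hconv
    (isClosed_epi hlsc) (convex_segment _ _) hcomp hdisj
  have hF : ∀ (z : X) (r : ℝ), F (z, r) = F (z, 0) + r * F (0, 1) := fun z r => by
    rw [← smul_eq_mul, ← map_smul, ← map_add, Prod.smul_mk, Prod.mk_add_mk, smul_zero, add_zero,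
      zero_add, smul_eq_mul, mul_one]
  have hFx : F (x, a) < u := hFu (x, a) ha.le
  have hFx' : w < F (x, a - ε) := hFw _ (left_mem_segment ℝ _ _)
  have hFy : w < F (y, d) := hFw _ (right_mem_segment ℝ _ _)
  rw [hF] at hFx hFx' hFy
  obtain ⟨c, hc⟩ : ∃ c, F (0, 1) = -c := ⟨-F (0, 1), (neg_neg _).symm⟩
  rw [hc] at hFx hFx' hFy
  have hc0 : 0 < c := by
    by_contra! hc0
    nlinarith
  let φ : WeakDual ℝ X := StrongDual.toWeakDual (c⁻¹ • F.comp (ContinuousLinearMap.inl ℝ X ℝ))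
  have hφ : ∀ z, F (z, 0) = c * φ z := fun z => (mul_inv_cancel_left₀ hc0.ne' _).symm
  rw [hφ] at hFx hFx' hFy
  refine ⟨φ, (mem_epsSubdiff_iff ha).2 fun z b hb => ?_, ?_⟩
  · have hFz : F (z, b) < u := hFu (z, b) hb
    rw [hF, hφ, hc] at hFz
    rw [map_sub]
    exact le_of_mul_le_mul_left (by linarith) hc0
  · rw [map_sub]
    exact lt_of_mul_lt_mul_left (by linarith) hc0.le

theorem exists_apply_lineMap_le_of_forall_epsSubdiff {g : X → EReal} {c γ D : ℝ}
    (hlsc : LowerSemicontinuous g) (hconv : Convex ℝ (epi g)) (hc : g x = c) (hγ : 0 < γ)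
    (hD : ∀ ψ ∈ epsSubdiff γ g x, ψ (y - x) ≤ D) :
    ∃ θ ∈ Icc (0 : ℝ) 1, g (lineMap x y θ) ≤ (lineMap (c - γ) (c + D) θ : ℝ) := by
  by_contra! h
  obtain ⟨ψ, hψ, hlt⟩ := exists_mem_epsSubdiff_lt_apply_sub (y := y) (d := c + D) hlsc hconv hc hγ
    (disjoint_right.2 fun p hp hpg => by
      rw [segment_eq_image_lineMap] at hp
      obtain ⟨θ, hθ, rfl⟩ := hp
      rw [epi, mem_ofPred_eq, fst_lineMap, snd_lineMap] at hpg
      exact (h θ hθ).not_ge hpg)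
  linarith [hD ψ hψ]

variable {f : T → X → EReal} {φ : WeakDual ℝ X} {γ : ℝ}

theorem exists_apply_lineMap_le_of_forall_activeSubdiff {a D : ℝ}
    (hlsc : ∀ t, LowerSemicontinuous (f t)) (hconv : ∀ t, Convex ℝ (epi (f t)))
    (ha : supFun f x = a) (hγ : 0 < γ) (hD : ∀ ψ ∈ activeSubdiff f γ x, ψ (y - x) ≤ D) (t : T) :
    ∃ θ ∈ Icc (0 : ℝ) 1, f t (lineMap x y θ) ≤ (lineMap (a - γ) (a + D) θ : ℝ) := by
  by_cases ht : t ∈ activeIdx f γ x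
  · have hle : f t x ≤ a := supFun_le_iff.1 ha.le t
    have hge : ((a - γ : ℝ) : EReal) ≤ f t x := by
      rw [EReal.coe_sub, ← ha]
      exact ht
    obtain ⟨c, hc⟩ : ∃ c : ℝ, f t x = c := ⟨_, (EReal.coe_toReal
      (hle.trans_lt (EReal.coe_lt_top a)).ne ((EReal.bot_lt_coe _).trans_le hge).ne').symm⟩
    obtain ⟨θ, hθ, h⟩ := exists_apply_lineMap_le_of_forall_epsSubdiff (hlsc t) (hconv t) hc hγ
      fun ψ hψ => hD ψ (mem_biUnion ht hψ)
    have hca : c ≤ a := by rwa [hc, EReal.coe_le_coe_iff] at hle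
    refine ⟨θ, hθ, h.trans (EReal.coe_le_coe_iff.2 ?_)⟩
    simp only [lineMap_apply_ring']
    linarith
  · have hlt : f t x < supFun f x - (γ : EReal) := not_le.1 ht
    rw [ha, ← EReal.coe_sub] at hlt
    exact ⟨0, left_mem_Icc.2 zero_le_one, by simpa only [lineMap_apply_zero] using hlt.le⟩

theorem coe_apply_sub_le_supportFun_activeSubdiff (hlsc : ∀ t, LowerSemicontinuous (f t))
    (hconv : ∀ t, Convex ℝ (epi (f t))) (hγ : 0 < γ) (hφ : φ ∈ subdiff (supFun f) x)
    (hy : y ∈ effDom (supFun f)) :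
    (φ (y - x) : EReal) ≤ supportFun (activeSubdiff f γ x) (y - x) := by
  refine coe_le_supportFun_iff.2 fun D hD => ?_
  obtain ⟨a, ha⟩ := exists_eq_coe_of_mem_epsSubdiff hφ
  obtain ⟨b, hb⟩ := exists_coe_ge_of_mem_effDom hy
  set m := |b - (a + D)|
  obtain ⟨η, hη0, hηm⟩ : ∃ η : ℝ, 0 < η ∧ η * (γ + m) = γ :=
    ⟨γ / (γ + m), by positivity, div_mul_cancel₀ _ (by positivity)⟩
  have hη1 : η ≤ 1 := by nlinarith [abs_nonneg (b - (a + D))]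
  have hline : supFun f (lineMap x y η) ≤ (lineMap a (a + D) η : ℝ) :=
    supFun_le_iff.2 fun t => by
      obtain ⟨θ, hθ, hmid⟩ :=
        exists_apply_lineMap_le_of_forall_activeSubdiff hlsc hconv ha hγ hD t
      exact apply_lineMap_le_of_apply_lineMap_sub_le (hconv t) (supFun_le_iff.1 ha.le t)
        (supFun_le_iff.1 hb t) hγ.le hθ hmid hη0 hη1 (by linarith)
  have hsub := (mem_epsSubdiff_iff ha).1 hφ _ _ hline
  rw [lineMap_apply_module', lineMap_apply_ring', add_sub_cancel_right, map_smul,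
    smul_eq_mul] at hsub
  exact le_of_mul_le_mul_left (by linarith) hη0

theorem subdiff_supFun_subset_closure (hlsc : ∀ t, LowerSemicontinuous (f t))
    (hconv : ∀ t, Convex ℝ (epi (f t))) {L : Submodule ℝ X} [FiniteDimensional ℝ L] (hxL : x ∈ L)
    (hγ : 0 < γ) :
    subdiff (supFun f) x ⊆ closure
      (convexHull ℝ (activeSubdiff f γ x) + normalCone (effDom (supFun f) ∩ (L : Set X)) x) := by
  intro φ hφ
  obtain ⟨a, ha⟩ := exists_eq_coe_of_mem_epsSubdiff hφ
  set C : Set X := effDom (supFun f) ∩ (L : Set X)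
  have hxC : x ∈ C := ⟨mem_effDom_of_le_coe ha.le, hxL⟩
  have hC : Convex ℝ C := (convex_effDom (epi_supFun f ▸ convex_iInter hconv)).inter L.convex
  refine mem_closure_convexHull_add (N := normalPointedCone hxC) fun v hv => ?_
  refine coe_apply_le_supportFun_of_mem_closure (K := feasibleCone C x)
    (feasibleCone_subset_submodule inter_subset_right hxL) (fun z hz => ?_) (fun z hz => ?_)
    (mem_closure_feasibleCone hxC hv)
  · obtain ⟨r, hr, hrz⟩ := exists_add_smul_mem_of_mem_feasibleCone hC hxC hz
    obtain ⟨b, hb⟩ := exists_coe_ge_of_mem_effDom hrz.1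
    have hbdd : supportFun (activeSubdiff f γ x) (r • z) ≤ (b - a + 2 * γ : ℝ) :=
      supportFun_le_coe_iff.2 fun ψ hψ => by
        simpa only [add_sub_cancel_left] using
          (mem_epsSubdiff_iff ha).1 (activeSubdiff_subset_epsSubdiff_supFun ha hψ) _ b hb
    exact mem_effDom_supportFun_of_smul hr (mem_effDom_of_le_coe hbdd)
  · obtain ⟨r, hr, hrz⟩ := exists_add_smul_mem_of_mem_feasibleCone hC hxC hz
    refine coe_apply_le_supportFun_of_smul hr ?_
    simpa only [add_sub_cancel_left] using
      coe_apply_sub_le_supportFun_activeSubdiff hlsc hconv hγ hφ hrz.1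

end Separation

section UpperEstimate

variable {X T : Type*} [AddCommGroup X] [Module ℝ X] [TopologicalSpace X] {f : T → X → EReal}
  {x y : X} {a b γ : ℝ} {L : Submodule ℝ X} {φ : WeakDual ℝ X}

theorem apply_sub_le_of_mem_closure (ha : supFun f x = a) (hb : supFun f y ≤ b) (hyL : y ∈ L)
    (hφ : φ ∈ closure
      (convexHull ℝ (activeSubdiff f γ x) + normalCone (effDom (supFun f) ∩ (L : Set X)) x)) :
    φ (y - x) ≤ b - a + 2 * γ := by
  have hclosed : IsClosed {ψ : WeakDual ℝ X | ψ (y - x) ≤ b - a + 2 * γ} :=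
    isClosed_le (WeakDual.eval_continuous (y - x)) continuous_const
  have hconvex : Convex ℝ {ψ : WeakDual ℝ X | ψ (y - x) ≤ b - a + 2 * γ} :=
    convex_halfSpace_le ⟨fun _ _ => rfl, fun _ _ => rfl⟩ _
  refine closure_minimal ?_ hclosed hφ
  rintro _ ⟨ψ, hψ, ν, hν, rfl⟩
  have hψy : ψ (y - x) ≤ b - a + 2 * γ :=
    convexHull_min (fun χ hχ =>
      (mem_epsSubdiff_iff ha).1 (activeSubdiff_subset_epsSubdiff_supFun ha hχ) y b hb) hconvex hψ
  have hνy : ν (y - x) ≤ 0 :=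
    (mem_normalCone_iff (mem_of_mem_normalCone hν)).1 hν y ⟨mem_effDom_of_le_coe hb, hyL⟩
  exact (add_le_add hψy hνy).trans_eq (add_zero _)

theorem exists_supFun_eq_coe_of_closure_nonempty
    (h : (closure
      (convexHull ℝ (activeSubdiff f γ x) +
        normalCone (effDom (supFun f) ∩ (L : Set X)) x)).Nonempty) :
    ∃ a : ℝ, supFun f x = a := by
  obtain ⟨_, ψ, hψ, ν, hν, -⟩ := closure_nonempty_iff.1 h
  obtain ⟨χ, hχ⟩ := convexHull_nonempty_iff.1 ⟨ψ, hψ⟩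
  obtain ⟨t, -, ht⟩ := mem_iUnion₂.1 hχ
  have hbot : ⊥ < supFun f x :=
    (bot_lt_iff_ne_bot.2 ht.2.1).trans_le (supFun_le_iff.1 le_rfl t)
  exact ⟨_, (EReal.coe_toReal (mem_of_mem_normalCone hν).1.ne hbot.ne').symm⟩

theorem iInter_closure_subset_subdiff_supFun (f : T → X → EReal) (x : X) :
    ⋂ L ∈ finDimThrough x, ⋂ γ ∈ Ioi (0 : ℝ), closure
      (convexHull ℝ (activeSubdiff f γ x) + normalCone (effDom (supFun f) ∩ (L : Set X)) x) ⊆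
    subdiff (supFun f) x := by
  intro φ hφ
  simp only [mem_iInter] at hφ
  have hspan : ∀ y : X, Submodule.span ℝ {x, y} ∈ finDimThrough x := fun y =>
    ⟨FiniteDimensional.span_of_finite ℝ (toFinite _), Submodule.subset_span (by simp)⟩
  obtain ⟨a, ha⟩ :=
    exists_supFun_eq_coe_of_closure_nonempty ⟨φ, hφ _ (hspan x) 1 (mem_Ioi.2 one_pos)⟩
  refine (mem_epsSubdiff_iff ha).2 fun y b hb => le_of_forall_pos_le_add fun δ hδ => ?_
  have h := apply_sub_le_of_mem_closure ha hb (Submodule.subset_span (by simp))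
    (hφ _ (hspan y) (δ / 2) (mem_Ioi.2 (half_pos hδ)))
  linarith

end UpperEstimate

end SupSubdiff

theorem mainTheorem11_general {X : Type*} [AddCommGroup X] [Module ℝ X] [TopologicalSpace X]
    [IsTopologicalAddGroup X] [ContinuousSMul ℝ X] [LocallyConvexSpace ℝ X]
    {T : Type*} (f : T → X → EReal) (hlsc : ∀ t, LowerSemicontinuous (f t))
    (hconv : ∀ t, Convex ℝ (SupSubdiff.epi (f t))) (x : X) :
    SupSubdiff.subdiff (SupSubdiff.supFun f) x =
      ⋂ L ∈ SupSubdiff.finDimThrough x, ⋂ γ ∈ Set.Ioi (0 : ℝ),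
        closure
          (convexHull ℝ
              (⋃ t ∈ SupSubdiff.activeIdx f γ x, SupSubdiff.epsSubdiff γ (f t) x) +
            SupSubdiff.normalCone
              (SupSubdiff.effDom (SupSubdiff.supFun f) ∩ (L : Set X)) x) := by
  refine Set.Subset.antisymm (Set.subset_iInter₂ fun L hL => Set.subset_iInter₂ fun γ hγ => ?_)
    (SupSubdiff.iInter_closure_subset_subdiff_supFun f x)
  have : FiniteDimensional ℝ L := hL.1
  exact SupSubdiff.subdiff_supFun_subset_closure hlsc hconv hL.2 hγ

theorem mainTheorem11 {X : Type*} [AddCommGroup X] [Module ℝ X] [TopologicalSpace X]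
    [IsTopologicalAddGroup X] [ContinuousSMul ℝ X] [LocallyConvexSpace ℝ X] [T2Space X]
    {T : Type*} (f : T → X → EReal) (hf : ∀ t, SupSubdiff.IsGammaZero (f t)) (x : X) :
    SupSubdiff.subdiff (SupSubdiff.supFun f) x =
      ⋂ L ∈ SupSubdiff.finDimThrough x, ⋂ γ ∈ Set.Ioi (0 : ℝ),
        closure
          (convexHull ℝ
              (⋃ t ∈ SupSubdiff.activeIdx f γ x, SupSubdiff.epsSubdiff γ (f t) x) +
            SupSubdiff.normalCone
              (SupSubdiff.effDom (SupSubdiff.supFun f) ∩ (L : Set X)) x) :=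
  mainTheorem11_general f (fun t => (hf t).lsc) (fun t => (hf t).convex) x
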